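/- Fix $\alpha>0$ and positive integers $M=M_N$ with $M_N/N^{1+\alpha}\to1$ as $N\to\infty$ (for instance $M_N=\lfloor N^{1+\alpha}\rfloor$). For each $N\ge 1$ let $(\eta(x,t),\,1\le x\le N;\ n_-(t),\,n_+(t))_{t\ge0}$ be the continuous-time Markov process on $\{0,1\}^{\{1,\dots,N\}}\times\{0,\dots,M\}\times\{0,\dots,M\}$ in which - for each $1\le x\le N-1$, the values $\eta(x)$ and $\eta(x+1)$ are exchanged at rate $\tfrac12$; - at rate $\tfrac12\big(1-\tfrac{n_-}{M}\big)\eta(1)+\tfrac12\,\tfrac{n_-}{M}(1-\eta(1))$ a particle moves between site $1$ and the left reservoir: $(\eta(1),n_-)$ goes from $(1,n_-)$ to $(0,n_-+1)$, or from $(0,n_-)$ to $(1,n_--1)$; - the same happens, with $N$ and $n_+$ in place of $1$ and $n_-$, at the right reservoir. Let $\mathbf P^N,\mathbf E^N$ be its law and expectation. Put $\eta(0,t)=n_-(t)/M$, $\eta(N+1,t)=n_+(t)/M$, $\rho^N(x,t)=\mathbf E^N[\eta(x,t)]$ for $0\le x\le N+1$, $\rho^N_-(t)=\rho^N(0,t)$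 and $\rho^N_+(t)=\rho^N(N+1,t)$. **Theorem (Adiabatic limit).** Let $u_0:(0,1]\to[0,1]$ be continuous on $(0,1)$ and let $v_{0,\pm}\in[0,1]$. Assume that the initial distributions satisfy $n_\pm(0)/M\to v_{0,\pm}$ in probability as $N\to\infty$, and $\rho^N(x,0)=u_0(x/N)$ for all $N\ge1$ and $1\le x\le N$. Then for all $r\in[0,1]$ and $t>0$, as $N\to\infty$, $$\rho^N_\pm(N^{2+\alpha}t)\to v_\pm(t),\qquad \rho^N(\lfloor Nr\rfloor,N^{2+\alpha}t)\to u(r,t):=\big(v_+(t)-v_-(t)\big)r+v_-(t),$$ where $v_\pm:[0,\infty)\to\mathbb R$ are continuous at $0$ with $v_\pm(0)=v_{0,\pm}$ and satisfy, for $t>0$, $$v_-'(t)=\tfrac12\big(v_+(t)-v_-(t)\big),\qquad v_+'(t)=-\tfrac12\big(v_+(t)-v_-(t)\big).$$ Explicitly, $v_\mp(t)=\dfrac{v_{0,-}+v_{0,+}}2\pm\dfrac{v_{0,-}-v_{0,+}}2\,e^{-t}$ for $t\ge0$. -/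

import Mathlib

open Filter Topology MeasureTheory

/-! ## Continuous-time Markov processes on a finite state space -/

section Markov

variable {S : Type*} [Fintype S] [DecidableEq S]

/-- The transition probability `p_t(a, b) = (e^{tL} 1_b)(a)` of the Markov semigroup generated by
an operator `L` acting on the functions on a finite set `S`. -/
noncomputable def transitionProb (L : (S → ℝ) →ₗ[ℝ] (S → ℝ)) (t : ℝ) (a b : S) : ℝ :=
  NormedSpace.exp (t • LinearMap.toContinuousLinearMap L) (Pi.single b 1) a

/-- `X` (only the times `t ≥ 0` matter) is a Markov process with generator `L` and arbitrary
initial distribution: its finite-dimensional distributions are given by the semigroup `e^{tL}`. -/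
structure IsMarkovProcess {Ω : Type*} [MeasurableSpace Ω] [MeasurableSpace S]
    (P : Measure Ω) (L : (S → ℝ) →ₗ[ℝ] (S → ℝ)) (X : ℝ → Ω → S) : Prop where
  measurable : ∀ t : ℝ, 0 ≤ t → Measurable (X t)
  finDimDist : ∀ (n : ℕ) (t : Fin (n + 1) → ℝ), 0 ≤ t 0 → Monotone t → ∀ a : Fin (n + 1) → S,
    P.real {w | ∀ i, X (t i) w = a i} =
      P.real {w | X (t 0) w = a 0} *
        ∏ i : Fin n, transitionProb L (t i.succ - t i.castSucc) (a i.castSucc) (a i.succ)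

end Markov

/-! ## The exclusion process in a channel with two particle reservoirs -/

namespace SSEP

/-- Configurations `(η, n₋, n₊)` in `{0,1}^{Λ_N} × {0,…,M} × {0,…,M}`; the site `x ∈ {1,…,N}` of
the channel is represented by `x - 1 : Fin N`, and `true` means that the site is occupied. -/
abbrev State (N M : ℕ) : Type := (Fin N → Bool) × Fin (M + 1) × Fin (M + 1)

variable {N M : ℕ}

/-- The channel occupation `η`. -/
def State.eta (ω : State N M) (x : Fin N) : Bool := ω.1 x

/-- The number of particles in the left reservoir. -/
def State.nLeft (ω : State N M) : Fin (M + 1) := ω.2.1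

/-- The number of particles in the right reservoir. -/
def State.nRight (ω : State N M) : Fin (M + 1) := ω.2.2

/-- `ω^{x,y}`: exchange the occupation numbers of the channel sites `x` and `y`. -/
def State.swap (ω : State N M) (x y : Fin N) : State N M :=
  (fun z => ω.eta (Equiv.swap x y z), ω.nLeft, ω.nRight)

/-- One more particle in a reservoir. (The truncation at `M` is never seen by the dynamics:
for `M ≥ 1` this move has rate zero when the reservoir is full.) -/
def incr (n : Fin (M + 1)) : Fin (M + 1) := ⟨min (n.val + 1) M, by omega⟩

/-- One particle fewer in a reservoir. (This move has rate zero when the reservoir is empty.) -/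
def decr (n : Fin (M + 1)) : Fin (M + 1) := ⟨n.val - 1, by omega⟩

/-- Change of a reservoir's content when it exchanges with a site whose occupation is `b`. -/
def exchange (b : Bool) (n : Fin (M + 1)) : Fin (M + 1) := if b then incr n else decr n

/-- `½ (1 - n/M) b + ½ (n/M) (1 - b)`: the rate of exchange between a boundary site with
occupation `b` and its reservoir containing `n` particles. -/
noncomputable def exchangeRate (b : Bool) (n : Fin (M + 1)) : ℝ :=
  if b then (1 / 2) * (1 - (n.val : ℝ) / M) else (1 / 2) * ((n.val : ℝ) / M)

/-- Move a particle between the channel site `x` and the left reservoir. -/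
def State.moveLeft (ω : State N M) (x : Fin N) : State N M :=
  (Function.update ω.eta x (!ω.eta x), exchange (ω.eta x) ω.nLeft, ω.nRight)

/-- Move a particle between the channel site `x` and the right reservoir. -/
def State.moveRight (ω : State N M) (x : Fin N) : State N M :=
  (Function.update ω.eta x (!ω.eta x), ω.nLeft, exchange (ω.eta x) ω.nRight)

/-- The generator of the process: stirring at rate `1/2` on the nearest neighbour bonds of the
channel, and exchange of the first (last) site with the left (right) reservoir. -/
noncomputable def generator (N M : ℕ) : (State N M → ℝ) →ₗ[ℝ] (State N M → ℝ) where
  toFun f ω :=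
    (1 / 2) * (∑ x : Fin N, ∑ y : Fin N,
      if x.val + 1 = y.val then f (ω.swap x y) - f ω else 0)
    + (∑ x : Fin N, if x.val + 1 = N then
        exchangeRate (ω.eta x) ω.nRight * (f (ω.moveRight x) - f ω) else 0)
    + ∑ x : Fin N, if x.val = 0 then
        exchangeRate (ω.eta x) ω.nLeft * (f (ω.moveLeft x) - f ω) else 0
  map_add' f g := by
    funext ω
    have h (p : Prop) [Decidable p] (c a b a' b' : ℝ) :
        (if p then c * (a + b - (a' + b')) else 0)
          = (if p then c * (a - a') else 0) + (if p then c * (b - b') else 0) := by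
      split_ifs <;> ring
    have h1 (p : Prop) [Decidable p] (a b a' b' : ℝ) :
        (if p then (a + b - (a' + b')) else 0)
          = (if p then (a - a') else 0) + (if p then (b - b') else 0) := by
      split_ifs <;> ring
    simp only [Pi.add_apply, h, h1, Finset.sum_add_distrib]
    ring
  map_smul' r f := by
    funext ω
    have h (p : Prop) [Decidable p] (c a a' : ℝ) :
        (if p then c * (r * a - r * a') else 0) = r * (if p then c * (a - a') else 0) := by
      split_ifs <;> ring
    have h1 (p : Prop) [Decidable p] (a a' : ℝ) :
        (if p then (r * a - r * a') else 0) = r * (if p then (a - a') else 0) := by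
      split_ifs <;> ring
    simp only [Pi.smul_apply, smul_eq_mul, RingHom.id_apply, h, h1, ← Finset.mul_sum]
    ring

/-- `η(x)` for `x ∈ {0,…,N+1}`: the occupation number of the channel site `x` if `1 ≤ x ≤ N`,
and the reservoir densities `η(0) = n₋/M`, `η(N+1) = n₊/M`. -/
noncomputable def State.occ (ω : State N M) (x : ℕ) : ℝ :=
  if x = 0 then (ω.nLeft.val : ℝ) / M
  else if h : x - 1 < N then (if ω.eta ⟨x - 1, h⟩ then 1 else 0)
  else (ω.nRight.val : ℝ) / M

/-- `ρ(x, t) = E[η(x, t)]`. -/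
noncomputable def density {Ω : Type*} [MeasurableSpace Ω] (P : Measure Ω)
    (X : ℝ → Ω → State N M) (x : ℕ) (t : ℝ) : ℝ :=
  ∫ w, (X t w).occ x ∂P

end SSEP

/-! The exchange rates make the mean current across every bond linear in the occupation numbers, so
the densities solve a closed linear system: the discrete heat equation in the channel, with each
reservoir a slow endpoint of capacity `M` (`exists_isReservoirHeatFlow`).

Two identities control the reservoirs. Conservation of total mass keeps `ρ 0 + ρ (N + 1)` constant
up to `N / M` (`abs_sum_sub_sum_le`). The centred first moment of the mass changes at the rate of
the sum of all bond currents, which telescopes to half the difference of the reservoir densities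
(`hasDerivAt_moment`). The channel contributes at most `N / M` to the normalised moment, so this
difference `D` nearly solves `D' = -D / (M (N + 1))`. As `M (N + 1)` is of order `N ^ (2 + α)`, the
factor `exp (-t)` appears in the limit (`abs_diff_sub_exp_le`).

The channel relaxes in time of order `N ^ 2`, during which the reservoirs hardly move; comparison
with an explicit supersolution then gives the linear profile (`discrete_heat_le_exp`,
`abs_sub_linear_le`). -/

namespace SSEP

/-! ### Action of the generator on the occupation numbers -/

variable {N M : ℕ}

theorem State.occ_zero (ω : State N M) : ω.occ 0 = (ω.nLeft.val : ℝ) / M := by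
  simp [State.occ]

theorem State.occ_succ (ω : State N M) (i : Fin N) :
    ω.occ (i.val + 1) = if ω.eta i then 1 else 0 := by
  simp [State.occ]

theorem State.occ_last (ω : State N M) : ω.occ (N + 1) = (ω.nRight.val : ℝ) / M := by
  simp [State.occ]

theorem State.moveLeft_eta (ω : State N M) (x : Fin N) :
    (ω.moveLeft x).eta = Function.update ω.eta x (!ω.eta x) := rfl

theorem State.moveRight_eta (ω : State N M) (x : Fin N) :
    (ω.moveRight x).eta = Function.update ω.eta x (!ω.eta x) := rfl

theorem State.occ_nonneg (ω : State N M) (x : ℕ) : 0 ≤ ω.occ x := by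
  unfold State.occ
  split_ifs <;> positivity

theorem State.occ_le_one (ω : State N M) (x : ℕ) : ω.occ x ≤ 1 := by
  have h (n : Fin (M + 1)) : (n.val : ℝ) / M ≤ 1 :=
    div_le_one_of_le₀ (by exact_mod_cast Nat.lt_succ_iff.mp n.isLt) (by positivity)
  unfold State.occ
  split_ifs
  exacts [h _, le_rfl, zero_le_one, h _]

/-- The truncations in `incr` and `decr` act only at `n = M` and `n = 0`, where the rate vanishes.
-/
theorem exchangeRate_mul (hM : 0 < M) (b : Bool) (n : Fin (M + 1)) :
    exchangeRate b n * (((exchange b n).val : ℝ) / M - (n.val : ℝ) / M)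
      = ((if b then 1 else 0) - (n.val : ℝ) / M) / (2 * M) := by
  have hM' : (M : ℝ) ≠ 0 := by positivity
  cases b
  · rcases Nat.eq_zero_or_pos n.val with h | h
    · simp [exchangeRate, h]
    · simp only [exchangeRate, exchange, decr, Bool.false_eq_true, if_false]
      rw [Nat.cast_sub h]
      field_simp
      push_cast
      ring
  · rcases Nat.lt_or_ge n.val M with h | h
    · simp only [exchangeRate, exchange, incr, if_true]
      rw [min_eq_left (by omega)]
      field_simp
      push_cast
      ring
    · have : n.val = M := by omega
      simp [exchangeRate, this, hM']

/-- The products of `n / M` with the occupation number cancel between the two directions of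
exchange. This linearity is what closes the equations for the means. -/
theorem exchangeRate_mul_flip (b : Bool) (n : Fin (M + 1)) :
    exchangeRate b n * ((if !b then 1 else 0) - if b then 1 else 0)
      = ((n.val : ℝ) / M - if b then 1 else 0) / 2 := by
  cases b <;> simp [exchangeRate] <;> ring

theorem generator_apply_of_pos (hN : 0 < N) (f : State N M → ℝ) (ω : State N M) :
    generator N M f ω =
      (1 / 2) * (∑ x : Fin N, ∑ y : Fin N, if x.val + 1 = y.val then f (ω.swap x y) - f ω else 0)
      + exchangeRate (ω.eta ⟨N - 1, by omega⟩) ω.nRight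
          * (f (ω.moveRight ⟨N - 1, by omega⟩) - f ω)
      + exchangeRate (ω.eta ⟨0, hN⟩) ω.nLeft * (f (ω.moveLeft ⟨0, hN⟩) - f ω) := by
  have hr (x : Fin N) : x.val + 1 = N ↔ x = ⟨N - 1, by omega⟩ := by
    rw [Fin.ext_iff]; simp only; omega
  have hl (x : Fin N) : x.val = 0 ↔ x = ⟨0, hN⟩ := by
    rw [Fin.ext_iff]
  simp only [generator, LinearMap.coe_mk, AddHom.coe_mk, hr, hl, Finset.sum_ite_eq',
    Finset.mem_univ, if_true]

theorem generator_occ_zero (hM : 0 < M) (hN : 0 < N) (ω : State N M) :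
    generator N M (fun ω => ω.occ 0) ω = (ω.occ 1 - ω.occ 0) / (2 * M) := by
  have h1 := ω.occ_succ ⟨0, hN⟩
  simp only [zero_add] at h1
  rw [generator_apply_of_pos hN]
  simp only [State.occ_zero, h1, ← exchangeRate_mul hM]
  simp [State.swap, State.moveLeft, State.moveRight, State.nLeft]

theorem generator_occ_last (hM : 0 < M) (hN : 0 < N) (ω : State N M) :
    generator N M (fun ω => ω.occ (N + 1)) ω = (ω.occ N - ω.occ (N + 1)) / (2 * M) := by
  have h1 := ω.occ_succ ⟨N - 1, by omega⟩
  simp only [Nat.sub_add_cancel hN] at h1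
  rw [generator_apply_of_pos hN]
  simp only [State.occ_last, h1, ← exchangeRate_mul hM]
  simp [State.swap, State.moveLeft, State.moveRight, State.nRight]

theorem sum_swap_sub (e : Fin N → ℝ) (i : Fin N) :
    (∑ x : Fin N, ∑ y : Fin N, if x.val + 1 = y.val then e (Equiv.swap x y i) - e i else 0)
      = (if h : i.val + 1 < N then e ⟨i.val + 1, h⟩ - e i else 0)
        + (if 0 < i.val then e ⟨i.val - 1, by omega⟩ - e i else 0) := by
  -- A swap affects `i` only if `i` is an endpoint of the bond, and it cannot be both endpoints, so
  -- the summand splits in two.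
  have key (x y : Fin N) : (if x.val + 1 = y.val then e (Equiv.swap x y i) - e i else 0)
      = (if x = i then if i.val + 1 = y.val then e y - e i else 0 else 0)
        + (if y = i then if x.val + 1 = i.val then e x - e i else 0 else 0) := by
    by_cases hxi : x = i
    · subst hxi
      by_cases hy : x.val + 1 = y.val
      · have : y ≠ x := by rintro rfl; omega
        simp [hy, this]
      · have : ¬ (y = x ∧ x.val + 1 = x.val) := by omega
        simp [hy]
    · by_cases hyi : y = i
      · subst hyi
        simp [hxi]
      · simp [hxi, hyi, Equiv.swap_apply_of_ne_of_ne (Ne.symm hxi) (Ne.symm hyi)]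
  simp only [key, Finset.sum_add_distrib]
  congr 1
  · rw [Finset.sum_comm]
    simp only [Finset.sum_ite_eq', Finset.mem_univ, if_true]
    split_ifs with h
    · rw [Finset.sum_eq_single ⟨i.val + 1, h⟩]
      · simp
      · intro y _ hy
        rw [if_neg fun h' => hy (Fin.ext h'.symm)]
      · simp
    · exact Finset.sum_eq_zero fun y _ => if_neg (by omega)
  · simp only [Finset.sum_ite_eq', Finset.mem_univ, if_true]
    split_ifs with h
    · rw [Finset.sum_eq_single ⟨i.val - 1, by omega⟩]
      · rw [if_pos (by simp only; omega)]
      · intro y _ hy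
        rw [if_neg fun h' => hy (Fin.ext (by simp only; omega))]
      · simp
    · exact Finset.sum_eq_zero fun y _ => if_neg (by omega)

theorem State.occ_eq_of_lt (ω : State N M) {x : ℕ} (hx : 0 < x) (h : x - 1 < N) :
    ω.occ x = if ω.eta ⟨x - 1, h⟩ then 1 else 0 := by
  simp [State.occ, hx.ne', h]

/-- Since `occ` takes the reservoir densities as its values at `0` and `N + 1`, exchange with a
reservoir supplies exactly the neighbour term missing from the stirring part. For `N = 1` both
neighbours are reservoirs. -/
theorem generator_occ_succ (i : Fin N) (ω : State N M) :
    generator N M (fun ω => ω.occ (i.val + 1)) ω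
      = (ω.occ i.val + ω.occ (i.val + 2) - 2 * ω.occ (i.val + 1)) / 2 := by
  have hN : 0 < N := i.pos
  have hleft : exchangeRate (ω.eta ⟨0, hN⟩) ω.nLeft
      * ((ω.moveLeft ⟨0, hN⟩).occ (i.val + 1) - ω.occ (i.val + 1))
      = if i.val = 0 then (ω.occ i.val - ω.occ (i.val + 1)) / 2 else 0 := by
    simp only [State.occ_succ]
    by_cases h : i.val = 0
    · have hi : i = ⟨0, hN⟩ := Fin.ext h
      subst hi
      rw [if_pos rfl, State.occ_zero, ← exchangeRate_mul_flip]
      simp [State.moveLeft_eta]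
    · have hi : i ≠ ⟨0, hN⟩ := fun h' => h (by rw [h'])
      simp [State.moveLeft_eta, h, Function.update_of_ne hi]
  have hright : exchangeRate (ω.eta ⟨N - 1, by omega⟩) ω.nRight
      * ((ω.moveRight ⟨N - 1, by omega⟩).occ (i.val + 1) - ω.occ (i.val + 1))
      = if i.val + 1 = N then (ω.occ (i.val + 2) - ω.occ (i.val + 1)) / 2 else 0 := by
    simp only [State.occ_succ]
    by_cases h : i.val + 1 = N
    · have hi : i = ⟨N - 1, by omega⟩ := Fin.ext (by simp only; omega)
      rw [if_pos h, show i.val + 2 = N + 1 by omega, State.occ_last, ← hi,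
        ← exchangeRate_mul_flip]
      simp [State.moveRight_eta]
    · have hi : i ≠ ⟨N - 1, by omega⟩ := fun h' => h (by rw [h']; simp only; omega)
      simp [State.moveRight_eta, h, Function.update_of_ne hi]
  rw [generator_apply_of_pos hN, hleft, hright]
  have hsum := sum_swap_sub (fun j => if ω.eta j then (1 : ℝ) else 0) i
  have hswap (x y : Fin N) : (ω.swap x y).occ (i.val + 1)
      = if ω.eta (Equiv.swap x y i) then 1 else 0 := (ω.swap x y).occ_succ i
  simp only [hswap, State.occ_succ]
  rw [hsum]
  have hp (h : i.val + 1 < N) := ω.occ_succ ⟨i.val + 1, h⟩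
  have hm (h : 0 < i.val) := ω.occ_eq_of_lt h (by omega)
  by_cases h0 : 0 < i.val <;> by_cases h1 : i.val + 1 < N
  · rw [dif_pos h1, if_pos h0, if_neg (show ¬ i.val + 1 = N by omega),
      if_neg (show ¬ i.val = 0 by omega), hm h0, hp h1]
    ring
  · rw [dif_neg h1, if_pos h0, if_pos (show i.val + 1 = N by omega),
      if_neg (show ¬ i.val = 0 by omega), hm h0]
    ring
  · rw [dif_pos h1, if_neg h0, if_neg (show ¬ i.val + 1 = N by omega),
      if_pos (show i.val = 0 by omega), hp h1]
    ring
  · rw [dif_neg h1, if_neg h0, if_pos (show i.val + 1 = N by omega),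
      if_pos (show i.val = 0 by omega)]
    ring

end SSEP

/-! ### Expectations of a Markov process through its semigroup -/

section MarkovExpectation

variable {S : Type*} [Fintype S]

/-- The expectation `∑ a, p a * (e^{tL} f) a` of `f` at time `t`, started from the weights `p`. -/
noncomputable def semigroupExpectation (p : S → ℝ) (L : (S → ℝ) →ₗ[ℝ] (S → ℝ)) (f : S → ℝ)
    (t : ℝ) : ℝ :=
  ∑ a, p a * NormedSpace.exp (t • LinearMap.toContinuousLinearMap L) f a

theorem hasDerivAt_semigroupExpectation (p : S → ℝ) (L : (S → ℝ) →ₗ[ℝ] (S → ℝ)) (f : S → ℝ)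
    (t : ℝ) :
    HasDerivAt (semigroupExpectation p L f) (semigroupExpectation p L (L f) t) t := by
  unfold semigroupExpectation
  refine HasDerivAt.fun_sum fun a _ => HasDerivAt.const_mul _ ?_
  have h := hasDerivAt_exp_smul_const (𝕂 := ℝ) (LinearMap.toContinuousLinearMap L) t
  have h2 := h.clm_apply (hasDerivAt_const t f)
  simpa using (hasDerivAt_pi.mp h2) a

theorem transitionProb_sum [DecidableEq S] (L : (S → ℝ) →ₗ[ℝ] (S → ℝ)) (f : S → ℝ) (t : ℝ) (a : S) :
    ∑ b, transitionProb L t a b * f b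
      = NormedSpace.exp (t • LinearMap.toContinuousLinearMap L) f a := by
  have hf : f = ∑ b, f b • Pi.single (M := fun _ => ℝ) b 1 := by
    ext c; simp [Finset.sum_apply, Pi.single_apply]
  conv_rhs => rw [hf]
  simp [transitionProb, map_sum, Finset.sum_apply, mul_comm]

variable {Ω : Type*} [MeasurableSpace Ω] [MeasurableSpace S] [MeasurableSingletonClass S]
  {P : Measure Ω} [IsProbabilityMeasure P] {L : (S → ℝ) →ₗ[ℝ] (S → ℝ)} {X : ℝ → Ω → S}

theorem integral_comp_eq_sum {Y : Ω → S} (hY : Measurable Y) (f : S → ℝ) :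
    ∫ w, f (Y w) ∂P = ∑ a, P.real {w | Y w = a} * f a := by
  have hm : IsProbabilityMeasure (P.map Y) := Measure.isProbabilityMeasure_map hY.aemeasurable
  rw [← integral_map (f := f) hY.aemeasurable (measurable_of_finite f).aestronglyMeasurable,
    integral_fintype (Integrable.of_finite)]
  refine Finset.sum_congr rfl fun a _ => ?_
  rw [map_measureReal_apply hY (measurableSet_singleton a), smul_eq_mul]
  rfl

theorem IsMarkovProcess.measureReal_eq [DecidableEq S] (hX : IsMarkovProcess P L X) {t : ℝ} (ht : 0 ≤ t) (b : S) :
    P.real {w | X t w = b} = ∑ a, P.real {w | X 0 w = a} * transitionProb L t a b := by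
  have h2 (a : S) : P.real {w | X 0 w = a ∧ X t w = b}
      = P.real {w | X 0 w = a} * transitionProb L t a b := by
    have := hX.finDimDist 1 ![0, t] (by simp) (by
      intro i j hij
      fin_cases i <;> fin_cases j <;> simp_all) ![a, b]
    simpa [Fin.forall_fin_two] using this
  simp_rw [← h2]
  have hm (s : ℝ) (hs : 0 ≤ s) (c : S) : MeasurableSet {w | X s w = c} :=
    hX.measurable s hs (measurableSet_singleton c)
  rw [← measureReal_biUnion_finset]
  · congr 1
    ext w
    simp
  · intro a _ a' _ haa'
    refine Set.disjoint_left.mpr fun w h h' => haa' (h.1.symm.trans h'.1)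
  · exact fun a _ => (hm 0 le_rfl a).inter (hm t ht b)

theorem IsMarkovProcess.integral_comp_eq [DecidableEq S] (hX : IsMarkovProcess P L X) (f : S → ℝ) {t : ℝ}
    (ht : 0 ≤ t) :
    ∫ w, f (X t w) ∂P = semigroupExpectation (fun a => P.real {w | X 0 w = a}) L f t := by
  rw [integral_comp_eq_sum (hX.measurable t ht)]
  simp_rw [hX.measureReal_eq ht, semigroupExpectation, ← transitionProb_sum, Finset.sum_mul,
    Finset.mul_sum]
  rw [Finset.sum_comm]
  simp only [mul_assoc]

end MarkovExpectation

/-! ### Maximum principle and relaxation for the discrete heat equation -/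

section MaximumPrinciple

/-- A derivative from which the function does not increase to the left is nonnegative. -/
theorem HasDerivAt.nonneg_of_forall_Icc_le {g : ℝ → ℝ} {g' a t : ℝ} (hg : HasDerivAt g g' t)
    (hat : a < t) (hle : ∀ s ∈ Set.Icc a t, g s ≤ g t) : 0 ≤ g' := by
  have h := (hasDerivAt_iff_tendsto_slope_left_right.mp hg).1
  refine ge_of_tendsto h ?_
  filter_upwards [Ioo_mem_nhdsLT hat] with s hs
  rw [slope_def_field]
  exact div_nonneg_of_nonpos (by linarith [hle s ⟨hs.1.le, hs.2.le⟩]) (by linarith [hs.2])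

/-- The weak maximum principle for the heat equation with generator `Δ/2` on `{0, …, n + 1}`. -/
theorem discrete_heat_maximum_principle {n : ℕ} {T : ℝ} {f : ℕ → ℝ → ℝ} {f' : ℕ → ℝ → ℝ}
    (hf : ∀ x ≤ n + 1, ∀ t, HasDerivAt (f x) (f' x t) t)
    (hsub : ∀ x < n, ∀ t ∈ Set.Icc 0 T,
      f' (x + 1) t ≤ (f x t + f (x + 2) t - 2 * f (x + 1) t) / 2)
    (hinit : ∀ x ≤ n + 1, f x 0 ≤ 0)
    (hleft : ∀ t ∈ Set.Icc 0 T, f 0 t ≤ 0) (hright : ∀ t ∈ Set.Icc 0 T, f (n + 1) t ≤ 0) :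
    ∀ x ≤ n + 1, ∀ t ∈ Set.Icc 0 T, f x t ≤ 0 := by
  intro x hx t ht
  have hT : 0 ≤ T := ht.1.trans ht.2
  by_contra! hpos
  -- Subtracting `ε * s` makes the inequality strict; this `ε` is small enough that a positive value
  -- survives up to time `T`.
  set ε : ℝ := f x t / (2 * (T + 1)) with hε
  have hε0 : 0 < ε := by positivity
  have hcont (z : ℕ) (hz : z ≤ n + 1) : Continuous fun s => f z s - ε * s :=
    (continuous_iff_continuousAt.mpr fun s => (hf z hz s).continuousAt).sub (by fun_prop)
  choose! τ hτ hτmax using fun (z : ℕ) (hz : z ≤ n + 1) =>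
    (isCompact_Icc (a := (0 : ℝ)) (b := T)).exists_isMaxOn ⟨0, by simp [hT]⟩
      (hcont z hz).continuousOn
  obtain ⟨y, hy, hymax⟩ := (Finset.range (n + 2)).exists_max_image
    (fun z => f z (τ z) - ε * τ z) ⟨0, by simp⟩
  have hyn : y ≤ n + 1 := by simpa [Nat.lt_succ_iff] using hy
  have hmax (z : ℕ) (hz : z ≤ n + 1) (s : ℝ) (hs : s ∈ Set.Icc 0 T) :
      f z s - ε * s ≤ f y (τ y) - ε * τ y :=
    (hτmax z hz hs).trans (hymax z (by simp; omega))
  set r := τ y with hr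
  have hrI : r ∈ Set.Icc 0 T := hτ y hyn
  have hval : 0 < f y r - ε * r := by
    refine lt_of_lt_of_le ?_ (hmax x hx t ht)
    have h1 : ε * t ≤ ε * (T + 1) := mul_le_mul_of_nonneg_left (by linarith [ht.2]) hε0.le
    have h2 : ε * (T + 1) = f x t / 2 := by rw [hε]; field_simp
    linarith
  have hfpos : 0 < f y r := by linarith [mul_nonneg hε0.le hrI.1]
  have hr0 : 0 < r := by
    rcases hrI.1.eq_or_lt with h | h
    · rw [← h] at hfpos; linarith [hinit y hyn]
    · exact h
  obtain ⟨z, rfl⟩ : ∃ z, y = z + 1 := by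
    rcases y with _ | z
    · linarith [hleft r hrI]
    · exact ⟨z, rfl⟩
  have hz : z < n := by
    by_contra h
    have : z = n := by omega
    subst this
    linarith [hright r hrI]
  -- The maximum may sit at `r = T`, so only left difference quotients are available. At a
  -- space-time maximum the discrete Laplacian is nonpositive, which contradicts a time derivative
  -- of at least `ε`.
  have hd : 0 ≤ f' (z + 1) r - ε := by
    have h : HasDerivAt (fun s => f (z + 1) s - ε * s) (f' (z + 1) r - ε * 1) r :=
      (hf _ hyn r).sub ((hasDerivAt_id r).const_mul ε)
    rw [mul_one] at h
    exact h.nonneg_of_forall_Icc_le hr0 fun s hs => hmax _ hyn s ⟨hs.1, hs.2.trans hrI.2⟩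
  linarith [hsub z hz r hrI, hmax z (by omega) r hrI, hmax (z + 2) (by omega) r hrI]

/-- A bounded solution of the heat equation with small boundary values is small after the
relaxation time, which is of order `n ^ 2`. -/
theorem discrete_heat_le_exp {n : ℕ} {T δ : ℝ} (hT : 0 ≤ T) (hδ : 0 ≤ δ)
    {f : ℕ → ℝ → ℝ} {f' : ℕ → ℝ → ℝ}
    (hf : ∀ x ≤ n + 1, ∀ t, HasDerivAt (f x) (f' x t) t)
    (hheat : ∀ x < n, ∀ t,
      f' (x + 1) t = (f x t + f (x + 2) t - 2 * f (x + 1) t) / 2)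
    (hinit : ∀ x ≤ n + 1, f x 0 ≤ 1)
    (hleft : ∀ t ∈ Set.Icc 0 T, f 0 t ≤ δ) (hright : ∀ t ∈ Set.Icc 0 T, f (n + 1) t ≤ δ)
    {x : ℕ} (hx : x ≤ n + 1) :
    f x T ≤ δ + 2 * Real.exp (-(T / (2 * (n + 1) ^ 2))) := by
  set l : ℝ := (n : ℝ) + 1 with hl
  have hl0 : 0 < l := by positivity
  -- The comparison function is `δ + E t * b x`. The profile `b` lies between `1` and `2` and has
  -- discrete Laplacian `-2 / l ^ 2`; with `b ≤ 2`, the decay rate `1 / (2 * l ^ 2)` of `E` makes it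
  -- a supersolution.
  set b : ℕ → ℝ := fun x => 2 - (x : ℝ) ^ 2 / l ^ 2 with hb
  have hbx (x : ℕ) (hx : x ≤ n + 1) : 1 ≤ b x := by
    have h1 : (x : ℝ) ≤ l := by rw [hl]; exact_mod_cast hx
    have h2 : (x : ℝ) ^ 2 / l ^ 2 ≤ 1 := div_le_one_of_le₀ (by gcongr) (by positivity)
    simp only [hb]; linarith
  have hb2 (x : ℕ) : b x ≤ 2 := by
    simp only [hb]; linarith [show 0 ≤ (x : ℝ) ^ 2 / l ^ 2 by positivity]
  set E : ℝ → ℝ := fun t => Real.exp (-(t / (2 * l ^ 2))) with hE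
  have hE0 (t : ℝ) : 0 < E t := Real.exp_pos _
  have hEd (t : ℝ) : HasDerivAt E (E t * (-(1 / (2 * l ^ 2)))) t :=
    (((hasDerivAt_id t).div_const (2 * l ^ 2)).neg).exp
  have hmp := discrete_heat_maximum_principle (n := n) (T := T)
    (f := fun x t => f x t - (δ + E t * b x))
    (f' := fun x t => f' x t - E t * (-(1 / (2 * l ^ 2))) * b x)
    (fun x hx t => (hf x hx t).sub (((hEd t).mul_const (b x)).const_add δ)) ?_ ?_ ?_ ?_ x hx T
    ⟨hT, le_rfl⟩
  · have : E T * b x ≤ E T * 2 := mul_le_mul_of_nonneg_left (hb2 x) (hE0 T).le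
    linarith
  · intro y hy t _
    have h1 : b y + b (y + 2) - 2 * b (y + 1) = -(2 / l ^ 2) := by
      simp only [hb]; push_cast; field_simp; ring
    have h2 : E t * (1 / (2 * l ^ 2)) * b (y + 1) ≤ E t * (1 / (2 * l ^ 2)) * 2 :=
      mul_le_mul_of_nonneg_left (hb2 _) (mul_nonneg (hE0 t).le (by positivity))
    have h3 : E t * (b y + b (y + 2) - 2 * b (y + 1)) / 2 = -(E t * (1 / (2 * l ^ 2)) * 2) := by
      rw [h1]; field_simp
    simp only [hheat y hy t]
    linarith
  · intro y hy
    have h0 : E 0 = 1 := by simp [hE]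
    simp only [h0]
    linarith [hinit y hy, hbx y hy]
  · intro t ht
    linarith [hleft t ht, mul_pos (hE0 t) (zero_lt_one.trans_le (hbx 0 (by omega)))]
  · intro t ht
    linarith [hright t ht, mul_pos (hE0 t) (zero_lt_one.trans_le (hbx (n + 1) le_rfl))]

end MaximumPrinciple

/-! ### The closed system for the densities -/

/-- The mean-field equation satisfied by the densities `ρ x`, `0 ≤ x ≤ N + 1`, of the exclusion
process in a channel of `N` sites with two reservoirs of size `M`. -/
structure IsReservoirHeatFlow (N M : ℕ) (ρ : ℕ → ℝ → ℝ) : Prop where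
  left : ∀ t, HasDerivAt (ρ 0) ((ρ 1 t - ρ 0 t) / (2 * M)) t
  right : ∀ t, HasDerivAt (ρ (N + 1)) ((ρ N t - ρ (N + 1) t) / (2 * M)) t
  channel : ∀ x < N, ∀ t,
    HasDerivAt (ρ (x + 1)) ((ρ x t + ρ (x + 2) t - 2 * ρ (x + 1) t) / 2) t
  mem_Icc : ∀ x ≤ N + 1, ∀ t, 0 ≤ t → ρ x t ∈ Set.Icc 0 1

/-- The process is specified only for `t ≥ 0`. The witness is the semigroup expectation, which
extends the densities to all real times and so has two-sided derivatives, also at `0`. -/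
theorem SSEP.exists_isReservoirHeatFlow {N M : ℕ} (hN : 0 < N) (hM : 0 < M) {Ω : Type*}
    [MeasurableSpace Ω] {P : Measure Ω} [IsProbabilityMeasure P] {X : ℝ → Ω → SSEP.State N M}
    (hX : IsMarkovProcess P (SSEP.generator N M) X) :
    ∃ ρ, IsReservoirHeatFlow N M ρ ∧ ∀ x t, 0 ≤ t → SSEP.density P X x t = ρ x t := by
  set p : SSEP.State N M → ℝ := fun a => P.real {w | X 0 w = a}
  set F : (SSEP.State N M → ℝ) → ℝ → ℝ := semigroupExpectation p (SSEP.generator N M) with hF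
  have hρ (x : ℕ) (t : ℝ) (ht : 0 ≤ t) :
      SSEP.density P X x t = F (fun ω => ω.occ x) t :=
    hX.integral_comp_eq (fun ω => ω.occ x) ht
  have hd (x : ℕ) (t : ℝ) := hasDerivAt_semigroupExpectation p (SSEP.generator N M)
    (fun ω => ω.occ x) t
  have hadd (f g : SSEP.State N M → ℝ) (t : ℝ) : F (f + g) t = F f t + F g t := by
    simp [hF, semigroupExpectation, mul_add, Finset.sum_add_distrib]
  have hsmul (c : ℝ) (f : SSEP.State N M → ℝ) (t : ℝ) : F (c • f) t = c * F f t := by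
    simp only [hF, semigroupExpectation, map_smul, Pi.smul_apply, smul_eq_mul, Finset.mul_sum]
    exact Finset.sum_congr rfl fun _ _ => by ring
  refine ⟨fun x => F fun ω => ω.occ x, ⟨fun t => ?_, fun t => ?_, fun x hx t => ?_, ?_⟩, hρ⟩
  · convert hd 0 t using 1
    have : SSEP.generator N M (fun ω => ω.occ 0)
        = (1 / (2 * M : ℝ)) • ((fun ω => ω.occ 1) + (-1 : ℝ) • fun ω => ω.occ 0) := by
      funext ω
      rw [SSEP.generator_occ_zero hM hN]
      simp only [Pi.smul_apply, Pi.add_apply, smul_eq_mul]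
      ring
    rw [this, ← hF, hsmul, hadd, hsmul]
    ring
  · convert hd (N + 1) t using 1
    have : SSEP.generator N M (fun ω => ω.occ (N + 1))
        = (1 / (2 * M : ℝ)) • ((fun ω => ω.occ N) + (-1 : ℝ) • fun ω => ω.occ (N + 1)) := by
      funext ω
      rw [SSEP.generator_occ_last hM hN]
      simp only [Pi.smul_apply, Pi.add_apply, smul_eq_mul]
      ring
    rw [this, ← hF, hsmul, hadd, hsmul]
    ring
  · convert hd (x + 1) t using 1
    have : SSEP.generator N M (fun ω => ω.occ (x + 1))
        = (1 / 2 : ℝ) • ((fun ω => ω.occ x) + ((fun ω => ω.occ (x + 2))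
          + (-2 : ℝ) • fun ω => ω.occ (x + 1))) := by
      funext ω
      rw [SSEP.generator_occ_succ ⟨x, hx⟩]
      simp only [Pi.smul_apply, Pi.add_apply, smul_eq_mul]
      ring
    rw [this, ← hF, hsmul, hadd, hadd, hsmul]
    ring
  · intro x _ t ht
    have hint : Integrable (fun w => (X t w).occ x) P := by
      refine Integrable.of_bound (C := 1)
        ((measurable_of_finite fun ω : SSEP.State N M => ω.occ x).comp
          (hX.measurable t ht)).aestronglyMeasurable (Eventually.of_forall fun w => ?_)
      rw [Real.norm_of_nonneg (SSEP.State.occ_nonneg _ _)]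
      exact SSEP.State.occ_le_one _ _
    rw [← hρ x t ht]
    refine ⟨integral_nonneg fun w => SSEP.State.occ_nonneg _ _, ?_⟩
    calc SSEP.density P X x t ≤ ∫ _, (1 : ℝ) ∂P :=
          integral_mono hint (integrable_const 1) fun w => SSEP.State.occ_le_one _ _
      _ = 1 := by simp

/-! ### Quantitative estimates on reservoirs and channel -/

namespace IsReservoirHeatFlow

variable {N M : ℕ} {ρ : ℕ → ℝ → ℝ}

theorem hasDerivAt_of_le (h : IsReservoirHeatFlow N M ρ) {x : ℕ} (hx : x ≤ N + 1) (t : ℝ) :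
    HasDerivAt (ρ x) (deriv (ρ x) t) t := by
  refine DifferentiableAt.hasDerivAt ?_
  rcases x with _ | x
  · exact (h.left t).differentiableAt
  · rcases (show x ≤ N by omega).eq_or_lt with rfl | hx'
    · exact (h.right t).differentiableAt
    · exact (h.channel x hx' t).differentiableAt

/-- The total mass is conserved, so that the mass of the reservoirs varies by at most `N`. -/
theorem abs_sum_sub_sum_le (h : IsReservoirHeatFlow N M ρ) (hM : 0 < M) {s t : ℝ} (hs : 0 ≤ s)
    (ht : 0 ≤ t) :
    |(ρ 0 t + ρ (N + 1) t) - (ρ 0 s + ρ (N + 1) s)| ≤ N / M := by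
  have hM' : (0 : ℝ) < M := by exact_mod_cast hM
  set C : ℝ → ℝ := fun t => ∑ x ∈ Finset.range N, ρ (x + 1) t with hC
  -- The Laplacian telescopes to the two boundary currents, which the reservoirs balance.
  have hsum (t : ℝ) (n : ℕ) : ∑ x ∈ Finset.range n, (ρ x t + ρ (x + 2) t - 2 * ρ (x + 1) t) / 2
      = (ρ 0 t - ρ 1 t + ρ (n + 1) t - ρ n t) / 2 := by
    induction n with
    | zero => simp
    | succ n ih => rw [Finset.sum_range_succ, ih]; ring
  have hderiv (t : ℝ) : HasDerivAt (fun t => M * (ρ 0 t + ρ (N + 1) t) + C t) 0 t := by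
    have h1 := (((h.left t).add (h.right t)).const_mul (M : ℝ)).add
      (HasDerivAt.fun_sum (u := Finset.range N) fun x hx => h.channel x (Finset.mem_range.mp hx) t)
    rw [hsum] at h1
    refine h1.congr_deriv ?_
    field_simp
    ring
  have hconst := is_const_of_deriv_eq_zero (fun t => (hderiv t).differentiableAt)
    (fun t => (hderiv t).deriv) t s
  have hCb (t : ℝ) (ht : 0 ≤ t) : 0 ≤ C t ∧ C t ≤ N := by
    have hb (x : ℕ) (hx : x ∈ Finset.range N) :=
      h.mem_Icc (x + 1) (by have := Finset.mem_range.mp hx; omega) t ht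
    refine ⟨Finset.sum_nonneg fun x hx => (hb x hx).1, ?_⟩
    simpa using Finset.sum_le_card_nsmul (Finset.range N) _ 1 fun x hx => (hb x hx).2
  rw [le_div_iff₀ hM', ← abs_of_pos hM', ← abs_mul, abs_le]
  have := hCb t ht
  have := hCb s hs
  constructor <;> linarith

/-- The first moment of the mass distribution about the centre of the channel, divided by
`M * (N + 1) / 2`. -/
noncomputable def moment (N M : ℕ) (ρ : ℕ → ℝ → ℝ) (t : ℝ) : ℝ :=
  (ρ (N + 1) t - ρ 0 t)
    + 2 / (M * (N + 1)) * ∑ x ∈ Finset.range N, ((x : ℝ) + 1 - (N + 1) / 2) * ρ (x + 1) t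

/-- The weights grow by one per site, so the unnormalised moment changes at the rate of the sum over
all bonds of `(ρ x - ρ (x + 1)) / 2`, which telescopes. The moment thus has a closed derivative,
whereas that of `ρ (N + 1) - ρ 0` involves the boundary sites. -/
theorem hasDerivAt_moment (h : IsReservoirHeatFlow N M ρ) (hM : 0 < M) (t : ℝ) :
    HasDerivAt (moment N M ρ) (-(1 / (M * (N + 1)) * (ρ (N + 1) t - ρ 0 t))) t := by
  have hM' : (0 : ℝ) < M := by exact_mod_cast hM
  have hN' : (0 : ℝ) < (N : ℝ) + 1 := by positivity
  have hsum (c : ℝ) (n : ℕ) : ∑ x ∈ Finset.range n,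
      ((x : ℝ) + 1 - c) * ((ρ x t + ρ (x + 2) t - 2 * ρ (x + 1) t) / 2)
      = (ρ 0 t - c * (ρ 0 t - ρ 1 t) + (n - c) * (ρ (n + 1) t - ρ n t) - ρ n t) / 2 := by
    induction n with
    | zero => simp; ring
    | succ n ih => rw [Finset.sum_range_succ, ih]; push_cast; ring
  have h1 := ((h.right t).sub (h.left t)).add
    ((HasDerivAt.fun_sum (u := Finset.range N) fun x hx =>
      (h.channel x (Finset.mem_range.mp hx) t).const_mul ((x : ℝ) + 1 - (N + 1) / 2)).const_mul
        (2 / (M * (N + 1) : ℝ)))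
  rw [hsum] at h1
  refine h1.congr_deriv ?_
  field_simp
  ring

theorem abs_moment_sub_le (h : IsReservoirHeatFlow N M ρ) (hM : 0 < M) {t : ℝ} (ht : 0 ≤ t) :
    |moment N M ρ t - (ρ (N + 1) t - ρ 0 t)| ≤ N / M := by
  have hM' : (0 : ℝ) < M := by exact_mod_cast hM
  have hN' : (0 : ℝ) < (N : ℝ) + 1 := by positivity
  rw [moment, add_sub_cancel_left, abs_mul, abs_of_pos (by positivity)]
  have hb (x : ℕ) (hx : x ∈ Finset.range N) :
      |((x : ℝ) + 1 - (N + 1) / 2) * ρ (x + 1) t| ≤ (N + 1) / 2 := by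
    have hx' := Finset.mem_range.mp hx
    have hρ := h.mem_Icc (x + 1) (by omega) t ht
    have hxN : (x : ℝ) + 1 ≤ N := by exact_mod_cast hx'
    rw [abs_mul, abs_of_nonneg hρ.1]
    refine (mul_le_of_le_one_right (abs_nonneg _) hρ.2).trans (abs_le.mpr ⟨?_, ?_⟩)
    · linarith [show (0 : ℝ) ≤ x by positivity]
    · linarith
  calc _ ≤ 2 / (M * (N + 1) : ℝ) * (N * ((N + 1) / 2)) := by
        gcongr
        refine (Finset.abs_sum_le_sum_abs _ _).trans ?_
        simpa using Finset.sum_le_card_nsmul (Finset.range N) _ _ hb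
    _ = N / M := by field_simp

/-- The difference of the reservoir densities decays exponentially at rate `1 / (M (N + 1))`. -/
theorem abs_diff_sub_exp_le (h : IsReservoirHeatFlow N M ρ) (hM : 0 < M) {t : ℝ} (ht : 0 ≤ t) :
    |(ρ (N + 1) t - ρ 0 t) - Real.exp (-(t / (M * (N + 1)))) * (ρ (N + 1) 0 - ρ 0 0)|
      ≤ 3 * (N / M) := by
  have hM' : (0 : ℝ) < M := by exact_mod_cast hM
  set c : ℝ := 1 / (M * (N + 1)) with hc
  have hc0 : 0 < c := by positivity
  set δ : ℝ := N / M with hδ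
  have hδ0 : 0 ≤ δ := by positivity
  set z := moment N M ρ with hz
  set D : ℝ → ℝ := fun t => ρ (N + 1) t - ρ 0 t with hD
  have hzD (s : ℝ) (hs : 0 ≤ s) := abs_le.mp (h.abs_moment_sub_le hM hs)
  have hzd (s : ℝ) : HasDerivAt z (-(c * D s)) s := h.hasDerivAt_moment hM s
  have hexp (s : ℝ) : HasDerivAt (fun s => Real.exp (c * s)) (Real.exp (c * s) * (c * 1)) s :=
    ((hasDerivAt_id s).const_mul c).exp
  -- A two-sided Grönwall argument: the derivative is `c * exp (c * s) * (δ + σ * (z s - D s))`,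
  -- nonnegative because `|z - D| ≤ δ`. Passing between `z` and `D` at times `0` and `t` costs `δ`
  -- each, and the Grönwall error is at most a third `δ`.
  have hmono (σ : ℝ) (hσ : σ = 1 ∨ σ = -1) :
      MonotoneOn (fun s => Real.exp (c * s) * (δ + σ * z s)) (Set.Ici 0) := by
    have hd (s : ℝ) := (hexp s).mul (((hzd s).const_mul σ).const_add δ)
    refine monotoneOn_of_deriv_nonneg (convex_Ici 0)
      (continuous_iff_continuousAt.mpr fun s => (hd s).continuousAt).continuousOn
      (fun s _ => (hd s).differentiableAt.differentiableWithinAt) fun s hs => ?_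
    rw [interior_Ici] at hs
    have hs' := hzD s (le_of_lt hs)
    refine ((hd s).deriv).symm ▸ ?_
    have : Real.exp (c * s) * (c * 1) * (δ + σ * z s) + Real.exp (c * s) * (σ * -(c * D s))
        = Real.exp (c * s) * c * (δ + σ * (z s - D s)) := by ring
    rw [this]
    refine mul_nonneg (by positivity) ?_
    rcases hσ with rfl | rfl <;> linarith
  have hE : Real.exp (c * t) * Real.exp (-(t / (M * (N + 1)))) = 1 := by
    rw [← Real.exp_add, hc, show 1 / (M * (N + 1) : ℝ) * t + -(t / (M * (N + 1))) = 0 by ring,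
      Real.exp_zero]
  set e := Real.exp (-(t / (M * (N + 1)))) with he
  have he0 : 0 < e := Real.exp_pos _
  have he1 : e ≤ 1 := Real.exp_le_one_iff.mpr (neg_nonpos.mpr (by positivity))
  have key (σ : ℝ) (hσ : σ = 1 ∨ σ = -1) : e * (δ + σ * z 0) ≤ δ + σ * z t := by
    have := hmono σ hσ (Set.mem_Ici.mpr le_rfl) (Set.mem_Ici.mpr ht) ht
    simp only [mul_zero, Real.exp_zero, one_mul] at this
    calc e * (δ + σ * z 0) ≤ e * (Real.exp (c * t) * (δ + σ * z t)) := by gcongr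
      _ = Real.exp (c * t) * e * (δ + σ * z t) := by ring
      _ = _ := by rw [hE, one_mul]
  have k1 := key 1 (Or.inl rfl)
  have k2 := key (-1) (Or.inr rfl)
  have h0 := hzD 0 le_rfl
  have ht' := hzD t ht
  have a1 : e * (z 0 - D 0) ≤ δ := by nlinarith
  have a2 : -δ ≤ e * (z 0 - D 0) := by nlinarith
  have a3 : 0 ≤ e * δ := by positivity
  change |D t - e * D 0| ≤ 3 * δ
  change -δ ≤ z t - D t ∧ z t - D t ≤ δ at ht'
  rw [abs_le]
  constructor <;> linarith

/-- Bounding the derivative of the difference directly would give only `(t - s) / M`, which need not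
be small over times of order `N ^ 2`. The moment gains the factor `N + 1`. -/
theorem abs_diff_sub_diff_le (h : IsReservoirHeatFlow N M ρ) (hM : 0 < M) {s t : ℝ} (hs : 0 ≤ s)
    (hst : s ≤ t) :
    |(ρ (N + 1) t - ρ 0 t) - (ρ (N + 1) s - ρ 0 s)|
      ≤ 2 * (N / M) + (t - s) / (M * (N + 1)) := by
  have hc0 : (0 : ℝ) ≤ 1 / (M * (N + 1)) := by positivity
  have hz : |moment N M ρ t - moment N M ρ s| ≤ 1 / (M * (N + 1)) * (t - s) := by
    have := Convex.norm_image_sub_le_of_norm_hasDerivWithin_le (f := moment N M ρ)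
      (s := Set.Ici (0 : ℝ)) (C := 1 / (M * (N + 1)))
      (fun x _ => (h.hasDerivAt_moment hM x).hasDerivWithinAt) (fun x hx => ?_) (convex_Ici 0)
      (Set.mem_Ici.mpr hs) (Set.mem_Ici.mpr (hs.trans hst))
    · simpa only [Real.norm_eq_abs, abs_of_nonneg (sub_nonneg.mpr hst)] using this
    · rw [norm_neg, Real.norm_eq_abs, abs_mul, abs_of_nonneg hc0]
      have h1 := h.mem_Icc (N + 1) le_rfl x hx
      have h2 := h.mem_Icc 0 (by omega) x hx
      exact mul_le_of_le_one_right hc0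
        (abs_le.mpr ⟨by linarith [h1.1, h2.2], by linarith [h1.2, h2.1]⟩)
  have h1 := abs_le.mp (h.abs_moment_sub_le hM hs)
  have h2 := abs_le.mp (h.abs_moment_sub_le hM (hs.trans hst))
  have h3 := abs_le.mp hz
  rw [one_div_mul_eq_div] at h3
  rw [abs_le]
  constructor <;> linarith

/-- After a time `τ` long compared to `N ^ 2`, the profile in the channel is close to linear. -/
theorem abs_sub_linear_le (h : IsReservoirHeatFlow N M ρ) (hM : 0 < M) {t τ : ℝ} (hτ : 0 ≤ τ)
    (hτt : τ ≤ t) {x : ℕ} (hx : x ≤ N + 1) :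
    |ρ x t - ((ρ (N + 1) t - ρ 0 t) * (x / (N + 1)) + ρ 0 t)|
      ≤ 2 * (2 * (N / M) + τ / (M * (N + 1))) + 2 * Real.exp (-(τ / (2 * (N + 1) ^ 2))) := by
  set δ : ℝ := 2 * (N / M) + τ / (M * (N + 1)) with hδ
  have hδ0 : 0 ≤ δ := by positivity
  set s := t - τ with hs
  have hs0 : 0 ≤ s := sub_nonneg.mpr hτt
  have hvar (r : ℝ) (hr : r ∈ Set.Icc 0 τ) :
      |ρ 0 (s + r) - ρ 0 s| ≤ δ ∧ |ρ (N + 1) (s + r) - ρ (N + 1) s| ≤ δ := by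
    have hr' : r / (M * (N + 1) : ℝ) ≤ τ / (M * (N + 1)) := by gcongr; exact hr.2
    have h1 := abs_le.mp (h.abs_sum_sub_sum_le hM hs0 (by linarith [hr.1] : 0 ≤ s + r))
    have h2 := abs_le.mp (h.abs_diff_sub_diff_le hM hs0 (by linarith [hr.1] : s ≤ s + r))
    rw [add_sub_cancel_left] at h2
    have h3 : (0 : ℝ) ≤ N / M := by positivity
    have h4 : (0 : ℝ) ≤ τ / (M * (N + 1)) := by positivity
    constructor <;> rw [abs_le] <;> constructor <;> linarith
  -- The line through the reservoir densities at time `s = t - τ` is stationary for the heat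
  -- equation, so `ρ - ℓ` solves it with boundary values at most `δ` in size.
  set ℓ : ℕ → ℝ := fun x => (ρ (N + 1) s - ρ 0 s) * (x / (N + 1)) + ρ 0 s with hℓ
  have hxN (x : ℕ) (hx : x ≤ N + 1) : (0 : ℝ) ≤ x / (N + 1) ∧ (x : ℝ) / (N + 1) ≤ 1 :=
    ⟨by positivity, div_le_one_of_le₀ (by exact_mod_cast hx) (by positivity)⟩
  have hℓ0 : ℓ 0 = ρ 0 s := by simp [hℓ]
  have hℓ1 : ℓ (N + 1) = ρ (N + 1) s := by
    have : (N : ℝ) + 1 ≠ 0 := by positivity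
    simp only [hℓ]; push_cast; rw [div_self this]; ring
  have hℓb (x : ℕ) (hx : x ≤ N + 1) : ℓ x ∈ Set.Icc (0 : ℝ) 1 := by
    have h1 := h.mem_Icc (N + 1) le_rfl s hs0
    have h2 := h.mem_Icc 0 (by omega) s hs0
    obtain ⟨h3, h4⟩ := hxN x hx
    have e : ℓ x = (1 - (x : ℝ) / (N + 1)) * ρ 0 s + (x / (N + 1)) * ρ (N + 1) s := by
      simp only [hℓ]; ring
    exact e ▸ (convex_Icc (0 : ℝ) 1) h2 h1 (by linarith) h3 (by ring)
  have hshift (y : ℕ) (hy : y ≤ N + 1) (r : ℝ) :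
      HasDerivAt (fun r => ρ y (s + r)) (deriv (ρ y) (s + r)) r := by
    simpa using (h.hasDerivAt_of_le hy (s + r)).comp_const_add s r
  have hheat (y : ℕ) (hy : y < N) (r : ℝ) : deriv (ρ (y + 1)) (s + r)
      = ((ρ y (s + r) - ℓ y) + (ρ (y + 2) (s + r) - ℓ (y + 2))
          - 2 * (ρ (y + 1) (s + r) - ℓ (y + 1))) / 2 := by
    rw [(h.channel y hy (s + r)).deriv]
    simp only [hℓ]; push_cast; ring
  have bound (σ : ℝ) (hσ : σ = 1 ∨ σ = -1) :
      σ * (ρ x (s + τ) - ℓ x) ≤ δ + 2 * Real.exp (-(τ / (2 * (N + 1) ^ 2))) := by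
    refine discrete_heat_le_exp (n := N) (f := fun y r => σ * (ρ y (s + r) - ℓ y))
      (f' := fun y r => σ * deriv (ρ y) (s + r)) hτ hδ0
      (fun y hy r => ((hshift y hy r).sub_const _).const_mul σ) ?_ ?_ ?_ ?_ hx
    · intro y hy r
      simp only [hheat y hy r]
      ring
    · intro y hy
      have h1 := h.mem_Icc y hy (s + 0) (by linarith)
      have h2 := hℓb y hy
      rcases hσ with rfl | rfl <;> linarith [h1.1, h1.2, h2.1, h2.2]
    · intro r hr
      have := abs_le.mp (hvar r hr).1
      rcases hσ with rfl | rfl <;> linarith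
    · intro r hr
      have := abs_le.mp (hvar r hr).2
      rcases hσ with rfl | rfl <;> linarith
  have b1 := bound 1 (Or.inl rfl)
  have b2 := bound (-1) (Or.inr rfl)
  have hst : s + τ = t := by rw [hs]; ring
  have hv := hvar τ ⟨hτ, le_rfl⟩
  rw [hst] at b1 b2 hv
  -- Moving the endpoints of the line from time `s` to time `t` costs a second `δ`.
  have hlin : |ℓ x - ((ρ (N + 1) t - ρ 0 t) * (x / (N + 1)) + ρ 0 t)| ≤ δ := by
    obtain ⟨h3, h4⟩ := hxN x hx
    have e : ℓ x - ((ρ (N + 1) t - ρ 0 t) * (x / (N + 1)) + ρ 0 t)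
        = (1 - (x : ℝ) / (N + 1)) * (ρ 0 s - ρ 0 t)
          + (x / (N + 1)) * (ρ (N + 1) s - ρ (N + 1) t) := by
      simp only [hℓ]; ring
    rw [e]
    have m1 : ρ 0 s - ρ 0 t ∈ Set.Icc (-δ) δ := by
      have := abs_le.mp hv.1; constructor <;> linarith
    have m2 : ρ (N + 1) s - ρ (N + 1) t ∈ Set.Icc (-δ) δ := by
      have := abs_le.mp hv.2; constructor <;> linarith
    exact abs_le.mpr ((convex_Icc (-δ) δ) m1 m2 (by linarith) h3 (by ring))
  have hlin' := abs_le.mp hlin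
  rw [abs_le]
  constructor <;> linarith

end IsReservoirHeatFlow

/-- Convergence in probability of a `[0, 1]`-valued variable to a constant implies convergence of
its mean. -/
theorem tendsto_integral_of_tendsto_measure {Ω : ℕ → Type*} [∀ N, MeasurableSpace (Ω N)]
    (P : ∀ N, Measure (Ω N)) [∀ N, IsProbabilityMeasure (P N)] {Y : ∀ N, Ω N → ℝ} {v : ℝ}
    (hY : ∀ N, Measurable (Y N)) (hY01 : ∀ N w, Y N w ∈ Set.Icc (0 : ℝ) 1)
    (hv : v ∈ Set.Icc (0 : ℝ) 1)
    (h : ∀ δ : ℝ, 0 < δ → Tendsto (fun N => P N {w | δ < |Y N w - v|}) atTop (𝓝 0)) :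
    Tendsto (fun N => ∫ w, Y N w ∂P N) atTop (𝓝 v) := by
  rw [Metric.tendsto_atTop']
  intro ε hε
  have hreal : Tendsto (fun N => (P N).real {w | ε / 2 < |Y N w - v|}) atTop (𝓝 0) := by
    exact (ENNReal.tendsto_toReal ENNReal.zero_ne_top).comp (h (ε / 2) (by positivity))
  obtain ⟨n, hn⟩ := eventually_atTop.mp (hreal.eventually_lt_const (half_pos hε))
  refine ⟨n, fun N hN => ?_⟩
  set A := {w | ε / 2 < |Y N w - v|} with hA
  have hAm : MeasurableSet A :=
    measurableSet_lt measurable_const ((hY N).sub_const v).abs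
  have hint : Integrable (Y N) (P N) :=
    Integrable.of_bound (C := 1) (hY N).aestronglyMeasurable (Eventually.of_forall fun w => by
      rw [Real.norm_of_nonneg (hY01 N w).1]; exact (hY01 N w).2)
  have hb (w : Ω N) : ‖Y N w - v‖ ≤ ε / 2 + A.indicator 1 w := by
    rw [Real.norm_eq_abs]
    by_cases hw : w ∈ A
    · rw [Set.indicator_of_mem hw, Pi.one_apply, abs_le]
      constructor <;> linarith [(hY01 N w).1, (hY01 N w).2, hv.1, hv.2]
    · rw [Set.indicator_of_notMem hw, add_zero]
      exact not_lt.mp hw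
  have hindint : Integrable (A.indicator (1 : Ω N → ℝ)) (P N) :=
    (integrable_const (1 : ℝ)).indicator hAm
  calc dist (∫ w, Y N w ∂P N) v = ‖∫ w, (Y N w - v) ∂P N‖ := by
        rw [integral_sub hint (integrable_const v)]
        simp [Real.dist_eq]
    _ ≤ ∫ w, (ε / 2 + A.indicator 1 w) ∂P N :=
        norm_integral_le_of_norm_le ((integrable_const _).add hindint) (Eventually.of_forall hb)
    _ = ε / 2 + (P N).real A := by
        rw [integral_add (integrable_const _) hindint, integral_indicator_one hAm]
        simp
    _ < ε := by linarith [hn N hN.le]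

/-! ### Asymptotics of the space, time and reservoir scales -/

section Scales

variable {α : ℝ} {M : ℕ → ℕ}

theorem tendsto_natCast_rpow_neg (hα : 0 < α) :
    Tendsto (fun N : ℕ => (N : ℝ) ^ (-α)) atTop (𝓝 0) :=
  (tendsto_rpow_neg_atTop hα).comp tendsto_natCast_atTop_atTop

theorem tendsto_natCast_add_one_div :
    Tendsto (fun N : ℕ => ((N : ℝ) + 1) / N) atTop (𝓝 1) := by
  simpa using (tendsto_natCast_div_add_atTop (𝕜 := ℝ) 1).inv₀ one_ne_zero

theorem eventually_pos_of_tendsto_ratio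
    (hM : Tendsto (fun N : ℕ => (M N : ℝ) / (N : ℝ) ^ (1 + α)) atTop (𝓝 1)) :
    ∀ᶠ N in atTop, 0 < N ∧ 0 < M N := by
  filter_upwards [hM.eventually_const_lt zero_lt_one, eventually_gt_atTop 0] with N h1 h2
  refine ⟨h2, Nat.pos_of_ne_zero fun h => ?_⟩
  simp [h] at h1

theorem tendsto_add_one_div_reservoir (hα : 0 < α)
    (hM : Tendsto (fun N : ℕ => (M N : ℝ) / (N : ℝ) ^ (1 + α)) atTop (𝓝 1)) :
    Tendsto (fun N : ℕ => ((N : ℝ) + 1) / M N) atTop (𝓝 0) := by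
  have h := (tendsto_natCast_add_one_div.mul (tendsto_natCast_rpow_neg hα)).mul
    (hM.inv₀ one_ne_zero)
  simp only [inv_one, mul_zero, zero_mul] at h
  refine h.congr' ?_
  filter_upwards [eventually_pos_of_tendsto_ratio hM] with N ⟨hN, hMN⟩
  have hN' : (0 : ℝ) < N := by exact_mod_cast hN
  have hM' : (0 : ℝ) < M N := by exact_mod_cast hMN
  have := Real.rpow_pos_of_pos hN' α
  rw [Real.rpow_add hN', Real.rpow_neg hN'.le, Real.rpow_one]
  field_simp

theorem tendsto_div_reservoir (hα : 0 < α)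
    (hM : Tendsto (fun N : ℕ => (M N : ℝ) / (N : ℝ) ^ (1 + α)) atTop (𝓝 1)) :
    Tendsto (fun N : ℕ => (N : ℝ) / M N) atTop (𝓝 0) :=
  squeeze_zero (fun N => by positivity) (fun N => by gcongr; linarith)
    (tendsto_add_one_div_reservoir hα hM)

theorem tendsto_time_div_reservoir
    (hM : Tendsto (fun N : ℕ => (M N : ℝ) / (N : ℝ) ^ (1 + α)) atTop (𝓝 1)) (t : ℝ) :
    Tendsto (fun N : ℕ => (N : ℝ) ^ (2 + α) * t / (M N * (N + 1))) atTop (𝓝 t) := by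
  have h := ((hM.inv₀ one_ne_zero).mul
    (tendsto_natCast_add_one_div.inv₀ one_ne_zero)).mul_const t
  simp only [inv_one, one_mul] at h
  refine h.congr' ?_
  filter_upwards [eventually_pos_of_tendsto_ratio hM] with N ⟨hN, hMN⟩
  have hN' : (0 : ℝ) < N := by exact_mod_cast hN
  have hM' : (0 : ℝ) < M N := by exact_mod_cast hMN
  have := Real.rpow_pos_of_pos hN' α
  rw [show (2 : ℝ) + α = 1 + (1 + α) by ring, Real.rpow_add hN' 1 (1 + α), Real.rpow_one]
  field_simp

theorem eventually_sq_le_time (hα : 0 < α) (K : ℝ) {t : ℝ} (ht : 0 < t) :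
    ∀ᶠ N : ℕ in atTop, K * ((N : ℝ) + 1) ^ 2 ≤ (N : ℝ) ^ (2 + α) * t := by
  have h := ((tendsto_natCast_add_one_div.pow 2).mul (tendsto_natCast_rpow_neg hα)).const_mul K
  simp only [mul_zero] at h
  filter_upwards [h.eventually_lt_const ht, eventually_gt_atTop 0] with N h1 hN
  have hN' : (0 : ℝ) < N := by exact_mod_cast hN
  have hp := Real.rpow_pos_of_pos hN' α
  have h2 : (N : ℝ) ^ (2 + α) = N ^ 2 * N ^ α := by
    rw [Real.rpow_add hN', Real.rpow_two]
  have h3 : K * ((N : ℝ) + 1) ^ 2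
      = N ^ 2 * N ^ α * (K * ((((N : ℝ) + 1) / N) ^ 2 * N ^ (-α))) := by
    rw [Real.rpow_neg hN'.le]; field_simp
  rw [h2, h3]
  gcongr

theorem tendsto_floor_mul_div_add_one {r : ℝ} (hr : 0 ≤ r) :
    Tendsto (fun N : ℕ => (⌊(N : ℝ) * r⌋₊ : ℝ) / (N + 1)) atTop (𝓝 r) := by
  have h := ((tendsto_nat_floor_mul_div_atTop (R := ℝ) hr).comp
    tendsto_natCast_atTop_atTop).mul (tendsto_natCast_add_one_div.inv₀ one_ne_zero)
  simp only [inv_one, mul_one] at h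
  refine h.congr' ?_
  filter_upwards [eventually_gt_atTop 0] with N hN
  have hN' : (0 : ℝ) < N := by exact_mod_cast hN
  simp only [Function.comp_apply, mul_comm r]
  field_simp

end Scales

/-! ### Passage to the limit -/

section Limits

variable {α : ℝ} {M : ℕ → ℕ} {ρ : ℕ → ℕ → ℝ → ℝ} {a b : ℝ}

theorem tendsto_reservoir_sum (hα : 0 < α)
    (hM : Tendsto (fun N : ℕ => (M N : ℝ) / (N : ℝ) ^ (1 + α)) atTop (𝓝 1))
    (hρ : ∀ᶠ N in atTop, IsReservoirHeatFlow N (M N) (ρ N))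
    (ha : Tendsto (fun N => ρ N 0 0) atTop (𝓝 a))
    (hb : Tendsto (fun N => ρ N (N + 1) 0) atTop (𝓝 b)) {T : ℕ → ℝ} (hT : ∀ N, 0 ≤ T N) :
    Tendsto (fun N => ρ N 0 (T N) + ρ N (N + 1) (T N)) atTop (𝓝 (a + b)) := by
  have h0 : Tendsto (fun N => (ρ N 0 (T N) + ρ N (N + 1) (T N)) - (ρ N 0 0 + ρ N (N + 1) 0))
      atTop (𝓝 0) := by
    refine squeeze_zero_norm' ?_ (tendsto_div_reservoir hα hM)
    filter_upwards [hρ, eventually_pos_of_tendsto_ratio hM] with N h hN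
    exact h.abs_sum_sub_sum_le hN.2 le_rfl (hT N)
  simpa using h0.add (ha.add hb)

theorem tendsto_reservoir_diff (hα : 0 < α)
    (hM : Tendsto (fun N : ℕ => (M N : ℝ) / (N : ℝ) ^ (1 + α)) atTop (𝓝 1))
    (hρ : ∀ᶠ N in atTop, IsReservoirHeatFlow N (M N) (ρ N))
    (ha : Tendsto (fun N => ρ N 0 0) atTop (𝓝 a))
    (hb : Tendsto (fun N => ρ N (N + 1) 0) atTop (𝓝 b)) {t : ℝ} (ht : 0 < t) :
    Tendsto (fun N : ℕ => ρ N (N + 1) ((N : ℝ) ^ (2 + α) * t) - ρ N 0 ((N : ℝ) ^ (2 + α) * t))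
      atTop (𝓝 (Real.exp (-t) * (b - a))) := by
  have h0 : Tendsto (fun N : ℕ =>
      (ρ N (N + 1) ((N : ℝ) ^ (2 + α) * t) - ρ N 0 ((N : ℝ) ^ (2 + α) * t))
        - Real.exp (-((N : ℝ) ^ (2 + α) * t / (M N * (N + 1)))) * (ρ N (N + 1) 0 - ρ N 0 0))
      atTop (𝓝 0) := by
    refine squeeze_zero_norm' ?_ (by simpa using (tendsto_div_reservoir hα hM).const_mul 3)
    filter_upwards [hρ, eventually_pos_of_tendsto_ratio hM] with N h hN
    exact h.abs_diff_sub_exp_le hN.2 (by positivity)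
  have h1 := (Real.continuous_exp.tendsto _).comp (tendsto_time_div_reservoir hM t).neg
  simpa using h0.add (h1.mul (hb.sub ha))

theorem tendsto_channel_sub_linear (hα : 0 < α)
    (hM : Tendsto (fun N : ℕ => (M N : ℝ) / (N : ℝ) ^ (1 + α)) atTop (𝓝 1))
    (hρ : ∀ᶠ N in atTop, IsReservoirHeatFlow N (M N) (ρ N)) {x : ℕ → ℕ} (hx : ∀ N, x N ≤ N + 1)
    {t : ℝ} (ht : 0 < t) :
    Tendsto (fun N : ℕ => ρ N (x N) ((N : ℝ) ^ (2 + α) * t)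
      - ((ρ N (N + 1) ((N : ℝ) ^ (2 + α) * t) - ρ N 0 ((N : ℝ) ^ (2 + α) * t)) * (x N / (N + 1))
        + ρ N 0 ((N : ℝ) ^ (2 + α) * t))) atTop (𝓝 0) := by
  rw [Metric.tendsto_atTop']
  intro ε hε
  -- The relaxation time is `τ = K * (N + 1) ^ 2`. Fixing `K` first makes the exponential small
  -- uniformly in `N`; the reservoir drift, of order `(1 + K) * N / M`, then vanishes as `N → ∞`.
  obtain ⟨K, hK, hK0⟩ : ∃ K : ℝ, 2 * Real.exp (-(K / 2)) < ε / 2 ∧ 0 ≤ K := by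
    have h1 : Tendsto (fun K : ℝ => 2 * Real.exp (-(K / 2))) atTop (𝓝 (2 * 0)) :=
      (Real.tendsto_exp_neg_atTop_nhds_zero.comp
        (tendsto_id.atTop_div_const two_pos)).const_mul 2
    rw [mul_zero] at h1
    exact ((h1.eventually_lt_const (half_pos hε)).and (eventually_ge_atTop 0)).exists
  have h2 := (((tendsto_div_reservoir hα hM).const_mul 2).add
    ((tendsto_add_one_div_reservoir hα hM).const_mul K)).const_mul 2
  simp only [mul_zero, add_zero] at h2
  have hev : ∀ᶠ N : ℕ in atTop, dist (ρ N (x N) ((N : ℝ) ^ (2 + α) * t)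
      - ((ρ N (N + 1) ((N : ℝ) ^ (2 + α) * t) - ρ N 0 ((N : ℝ) ^ (2 + α) * t)) * (x N / (N + 1))
        + ρ N 0 ((N : ℝ) ^ (2 + α) * t))) 0 < ε := by
    filter_upwards [hρ, eventually_pos_of_tendsto_ratio hM, eventually_sq_le_time hα K ht,
      h2.eventually_lt_const (half_pos hε)] with N h hN hτ hsmall
    have hM' : (0 : ℝ) < M N := by exact_mod_cast hN.2
    have hb := h.abs_sub_linear_le hN.2 (by positivity) hτ (hx N)
    have e1 : K * ((N : ℝ) + 1) ^ 2 / (M N * (N + 1)) = K * ((N + 1) / M N) := by field_simp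
    have e2 : K * ((N : ℝ) + 1) ^ 2 / (2 * (N + 1) ^ 2) = K / 2 := by field_simp
    rw [e1, e2] at hb
    rw [Real.dist_eq, sub_zero]
    linarith
  obtain ⟨n, hn⟩ := eventually_atTop.mp hev
  exact ⟨n, fun N hN => hn N hN.le⟩

end Limits

theorem mainTheorem4
    (α : ℝ) (hα : 0 < α)
    -- the reservoir sizes, `M N ~ N ^ (1 + α)`
    (M : ℕ → ℕ)
    (hM : Tendsto (fun N : ℕ => (M N : ℝ) / (N : ℝ) ^ (1 + α)) atTop (𝓝 1))
    -- for every `N`, the particle process, with its own probability space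
    {Ω : ℕ → Type*} [∀ N, MeasurableSpace (Ω N)]
    (P : ∀ N, Measure (Ω N)) [∀ N, IsProbabilityMeasure (P N)]
    (X : ∀ N, ℝ → Ω N → SSEP.State N (M N))
    (hX : ∀ N, IsMarkovProcess (P N) (SSEP.generator N (M N)) (X N))
    -- the initial data
    (u₀ : ℝ → ℝ) (hu₀ : ContinuousOn u₀ (Set.Ioo 0 1))
    (hu₀' : ∀ r ∈ Set.Ioo (0 : ℝ) 1, u₀ r ∈ Set.Icc (0 : ℝ) 1)
    (vm₀ vp₀ : ℝ) (hvm₀ : vm₀ ∈ Set.Icc (0 : ℝ) 1) (hvp₀ : vp₀ ∈ Set.Icc (0 : ℝ) 1)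
    (hleft : ∀ δ : ℝ, 0 < δ → Tendsto
      (fun N => P N {w | δ < |((X N 0 w).nLeft.val : ℝ) / M N - vm₀|}) atTop (𝓝 0))
    (hright : ∀ δ : ℝ, 0 < δ → Tendsto
      (fun N => P N {w | δ < |((X N 0 w).nRight.val : ℝ) / M N - vp₀|}) atTop (𝓝 0))
    (hchannel : ∀ N x : ℕ, 1 ≤ x → x ≤ N →
      SSEP.density (P N) (X N) x 0 = u₀ ((x : ℝ) / N)) :
    ∃ vm vp : ℝ → ℝ,
      -- the system of differential equations with its initial conditions
      (∀ t : ℝ, 0 < t → HasDerivAt vm ((1 / 2) * (vp t - vm t)) t) ∧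
      (∀ t : ℝ, 0 < t → HasDerivAt vp (-(1 / 2) * (vp t - vm t)) t) ∧
      vm 0 = vm₀ ∧ vp 0 = vp₀ ∧
      Tendsto vm (𝓝[>] 0) (𝓝 vm₀) ∧ Tendsto vp (𝓝[>] 0) (𝓝 vp₀) ∧
      -- its explicit solution
      (∀ t : ℝ, 0 ≤ t → vm t = (vm₀ + vp₀) / 2 + (vm₀ - vp₀) / 2 * Real.exp (-t)) ∧
      (∀ t : ℝ, 0 ≤ t → vp t = (vm₀ + vp₀) / 2 - (vm₀ - vp₀) / 2 * Real.exp (-t)) ∧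
      -- the limits of the reservoir densities and of the channel density
      (∀ t : ℝ, 0 < t → Tendsto
        (fun N : ℕ => SSEP.density (P N) (X N) 0 ((N : ℝ) ^ (2 + α) * t))
        atTop (𝓝 (vm t))) ∧
      (∀ t : ℝ, 0 < t → Tendsto
        (fun N : ℕ => SSEP.density (P N) (X N) (N + 1) ((N : ℝ) ^ (2 + α) * t))
        atTop (𝓝 (vp t))) ∧
      (∀ r ∈ Set.Icc (0 : ℝ) 1, ∀ t : ℝ, 0 < t → Tendsto
        (fun N : ℕ => SSEP.density (P N) (X N) ⌊(N : ℝ) * r⌋₊ ((N : ℝ) ^ (2 + α) * t))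
        atTop (𝓝 ((vp t - vm t) * r + vm t))) := by
  -- The heat flow is obtained only when `N` and `M N` are positive, which holds eventually; `0` is
  -- a default for the other `N`.
  have hρex (N : ℕ) : ∃ ρ : ℕ → ℝ → ℝ, 0 < N ∧ 0 < M N → IsReservoirHeatFlow N (M N) ρ ∧
      ∀ x t, 0 ≤ t → SSEP.density (P N) (X N) x t = ρ x t := by
    by_cases h : 0 < N ∧ 0 < M N
    · obtain ⟨ρ, hρ⟩ := SSEP.exists_isReservoirHeatFlow h.1 h.2 (hX N)
      exact ⟨ρ, fun _ => hρ⟩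
    · exact ⟨0, fun h' => absurd h' h⟩
  choose ρ hρ using hρex
  have hpos := eventually_pos_of_tendsto_ratio hM
  have hflow : ∀ᶠ N in atTop, IsReservoirHeatFlow N (M N) (ρ N) :=
    hpos.mono fun N h => (hρ N h).1
  have heq (x : ℕ → ℕ) (T : ℕ → ℝ) (hT : ∀ N, 0 ≤ T N) :
      (fun N => ρ N (x N) (T N)) =ᶠ[atTop] fun N => SSEP.density (P N) (X N) (x N) (T N) :=
    hpos.mono fun N h => ((hρ N h).2 (x N) (T N) (hT N)).symm
  have hinit (x : ℕ → ℕ) (v : ℝ) (hv : v ∈ Set.Icc (0 : ℝ) 1)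
      (h : ∀ δ : ℝ, 0 < δ → Tendsto (fun N => P N {w | δ < |(X N 0 w).occ (x N) - v|})
        atTop (𝓝 0)) : Tendsto (fun N => ρ N (x N) 0) atTop (𝓝 v) :=
    (tendsto_integral_of_tendsto_measure P (Y := fun N w => (X N 0 w).occ (x N))
      (fun N => (measurable_of_finite fun ω : SSEP.State N (M N) => ω.occ (x N)).comp
        ((hX N).measurable 0 le_rfl))
      (fun N w => ⟨SSEP.State.occ_nonneg _ _, SSEP.State.occ_le_one _ _⟩) hv h).congr'
      (heq x 0 fun _ => le_rfl).symm
  have ha : Tendsto (fun N => ρ N 0 0) atTop (𝓝 vm₀) :=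
    hinit (fun _ => 0) vm₀ hvm₀ (by simpa only [SSEP.State.occ_zero] using hleft)
  have hb : Tendsto (fun N => ρ N (N + 1) 0) atTop (𝓝 vp₀) :=
    hinit (fun N => N + 1) vp₀ hvp₀ (by simpa only [SSEP.State.occ_last] using hright)
  have hT (t : ℝ) (ht : 0 < t) (N : ℕ) : 0 ≤ (N : ℝ) ^ (2 + α) * t := by positivity
  have hL (t : ℝ) (ht : 0 < t) : Tendsto (fun N : ℕ => ρ N 0 ((N : ℝ) ^ (2 + α) * t)) atTop
      (𝓝 ((vm₀ + vp₀) / 2 + (vm₀ - vp₀) / 2 * Real.exp (-t))) := by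
    have h := ((tendsto_reservoir_sum hα hM hflow ha hb (hT t ht)).sub
      (tendsto_reservoir_diff hα hM hflow ha hb ht)).div_const 2
    convert h using 2 <;> ring
  have hR (t : ℝ) (ht : 0 < t) : Tendsto (fun N : ℕ => ρ N (N + 1) ((N : ℝ) ^ (2 + α) * t)) atTop
      (𝓝 ((vm₀ + vp₀) / 2 - (vm₀ - vp₀) / 2 * Real.exp (-t))) := by
    have h := ((tendsto_reservoir_sum hα hM hflow ha hb (hT t ht)).add
      (tendsto_reservoir_diff hα hM hflow ha hb ht)).div_const 2
    convert h using 2 <;> ring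
  have hexp (t : ℝ) : HasDerivAt (fun t : ℝ => Real.exp (-t)) (Real.exp (-t) * -1) t :=
    (hasDerivAt_id t).neg.exp
  refine ⟨fun t => (vm₀ + vp₀) / 2 + (vm₀ - vp₀) / 2 * Real.exp (-t),
    fun t => (vm₀ + vp₀) / 2 - (vm₀ - vp₀) / 2 * Real.exp (-t), fun t _ => ?_, fun t _ => ?_,
    ?_, ?_, ?_, ?_, fun _ _ => rfl, fun _ _ => rfl, fun t ht => ?_, fun t ht => ?_,
    fun r hr t ht => ?_⟩
  · exact (((hexp t).const_mul _).const_add _).congr_deriv (by ring)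
  · exact (((hexp t).const_mul _).const_sub _).congr_deriv (by ring)
  · simp only [neg_zero, Real.exp_zero]; ring
  · simp only [neg_zero, Real.exp_zero]; ring
  · refine Tendsto.mono_left (Continuous.tendsto' (by fun_prop) _ _ ?_) nhdsWithin_le_nhds
    simp only [neg_zero, Real.exp_zero]; ring
  · refine Tendsto.mono_left (Continuous.tendsto' (by fun_prop) _ _ ?_) nhdsWithin_le_nhds
    simp only [neg_zero, Real.exp_zero]; ring
  · exact (hL t ht).congr' (heq (fun _ => 0) _ (hT t ht))
  · exact (hR t ht).congr' (heq (fun N => N + 1) _ (hT t ht))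
  -- The index may be `0`, the left reservoir; the linear-profile estimate covers `0` and `N + 1` as
  -- well.
  · have hx (N : ℕ) : ⌊(N : ℝ) * r⌋₊ ≤ N + 1 := by
      refine (Nat.floor_le_of_le ?_).trans N.le_succ
      exact mul_le_of_le_one_right (Nat.cast_nonneg N) hr.2
    refine Tendsto.congr' (heq (fun N => ⌊(N : ℝ) * r⌋₊) _ (hT t ht)) ?_
    have h := (tendsto_channel_sub_linear hα hM hflow hx ht).add
      ((((hR t ht).sub (hL t ht)).mul (tendsto_floor_mul_div_add_one hr.1)).add (hL t ht))
    simpa only [sub_add_cancel, zero_add] using h
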